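/- Let $r\ge 0$ be an integer, $a_1,\dots,a_r$ positive real numbers, $x\in\mathbb{C}$ with $\operatorname{Re}(x)>0$, and $u\in\mathbb{C}$ with $|u|\ge 1$ and $u^{a_j}\neq 1$ for $j=1,\dots,r$ (complex powers are principal values). Define the multiple Frobenius–Euler polynomials $H_{r,n}(x,u|a_1,\dots,a_r)$, $n\ge 0$, by the generating function $$\prod_{j=1}^{r}\frac{1-u^{a_j}}{e^{a_jt}-u^{a_j}}\,e^{xt}=\sum_{n=0}^{\infty}H_{r,n}(x,u|a_1,\dots,a_r)\frac{t^n}{n!}.$$ Then the Barnes-type multiple Frobenius–Euler $l$-function $$l_r(s,x;u|a_1,\dots,a_r)=\sum_{n_1,\dots,n_r=0}^{\infty}\frac{u^{-(n_1a_1+\cdots+n_ra_r)}}{(x+n_1a_1+\cdots+n_ra_r)^{s}},\qquad \operatorname{Re}(s)>r,$$ in which the series converges absolutely, extends uniquely to an entire function of $s$, and for every integer $n\ge 0$ $$\prod_{j=1}^{r}\left(1-u^{-a_j}\right)\,l_r(-n,x;u|a_1,\dots,a_r)=H_{r,n}(x,u|a_1,\dots,a_r).$$ -/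

import Mathlib

/-- The generating function `∏ⱼ (1 - u ^ aⱼ) / (e ^ (aⱼ t) - u ^ aⱼ) * e ^ (x t)`, as a formal power
series in `t`. Powers of `u` are principal values. The denominators are invertible power series
exactly when `u ^ aⱼ ≠ 1` for all `j`. -/
noncomputable def frobeniusEulerGenFun {r : ℕ} (a : Fin r → ℝ) (u x : ℂ) : PowerSeries ℂ :=
  (∏ j, PowerSeries.C (1 - u ^ (a j : ℂ)) *
      (PowerSeries.rescale (a j : ℂ) (PowerSeries.exp ℂ) - PowerSeries.C (u ^ (a j : ℂ)))⁻¹) *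
    PowerSeries.rescale x (PowerSeries.exp ℂ)

/-- The multiple Frobenius-Euler polynomial `H_{r,n}(x, u | a₁, …, aᵣ)`: the coefficient of
`t ^ n / n!` in the generating function. -/
noncomputable def multipleFrobeniusEuler {r : ℕ} (n : ℕ) (x u : ℂ) (a : Fin r → ℝ) : ℂ :=
  (n.factorial : ℂ) * PowerSeries.coeff n (frobeniusEulerGenFun a u x)

/-- The term `u ^ (-(n₁ a₁ + ⋯ + nᵣ aᵣ)) / (x + n₁ a₁ + ⋯ + nᵣ aᵣ) ^ s` of the series
defining `l_r(s, x; u | a₁, …, aᵣ)`, with principal values of all powers. -/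
noncomputable def multipleLTerm {r : ℕ} (s x u : ℂ) (a : Fin r → ℝ) (m : Fin r → ℕ) : ℂ :=
  u ^ (-∑ j, (m j : ℂ) * (a j : ℂ)) / (x + ∑ j, (m j : ℂ) * (a j : ℂ)) ^ s

/-- `L` is the function `s ↦ l_r(s, x; u | a₁, …, aᵣ)`: it is the sum of the (absolutely convergent)
multiple series in the half-plane `Re s > r`, and is continued analytically to all of `ℂ`. -/
structure IsMultipleL {r : ℕ} (x u : ℂ) (a : Fin r → ℝ) (L : ℂ → ℂ) : Prop where
  entire : Differentiable ℂ L
  hasSum : ∀ s : ℂ, (r : ℝ) < s.re → HasSum (fun m : Fin r → ℕ => multipleLTerm s x u a m) (L s)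

/-!
Put `wⱼ = u ^ (-aⱼ)`, so that `‖wⱼ‖ ≤ 1` and `wⱼ ≠ 1`, and let
`f(t) = e ^ (-x t) ∏ⱼ (1 - wⱼ e ^ (-aⱼ t))⁻¹`. Expanding the geometric series and integrating termwise
against `t ^ (s - 1)` shows that for `Re s > r` the multiple series equals `Γ(s)⁻¹ ∫₀^∞ f(t) t ^ (s - 1) dt`
(`hasSum_mellin_multiple`); absolute convergence is `summable_linear_rpow`, and the rates being complex,
the Gamma integral is needed in the form `integral_cpow_mul_exp_neg_complex_mul`.

Since `wⱼ ≠ 1`, the function `f` is smooth up to `t = 0`, and it decays exponentially with all its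
derivatives. Integrating by parts `N` times turns the integral into
`(-1) ^ N Γ(s + N)⁻¹ ∫₀^∞ f⁽ᴺ⁾(t) t ^ (s + N - 1) dt`, which is holomorphic for `Re s > -N`; these
expressions glue to an entire function, and `N = n + 1`, `s = -n` gives the value `(-1) ^ n f⁽ⁿ⁾(0)`
(`IsExpDecayingTower.exists_entire`).

Up to the constant `∏ⱼ (1 - wⱼ)`, the function `f(-t)` is the generating function of the multiple
Frobenius–Euler polynomials (`frobeniusEulerGenFun_eq`). To identify the derivatives `f⁽ⁿ⁾(0)` with
coefficients of a formal power series, functions are paired with power series: the algebra generated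
by the exponentials and the geometric factors, each with its formal counterpart in `X = -t`, is closed
under `(d/dt, -d/dX)`, consists of functions bounded on `[0, ∞)`, and values at `0` are constant
coefficients (`jet_properties`, `exists_tower`). Uniqueness is the identity theorem.
-/

/-! ### Analytic continuation of Mellin transforms -/

section Mellin

open Complex Set Filter Topology MeasureTheory Asymptotics

/-- `f 0, f 1, f 2, …` are the successive derivatives on `[0, ∞)` of the function `f 0`, and they all
decay exponentially with a common rate. -/
structure IsExpDecayingTower (f : ℕ → ℝ → ℂ) : Prop where
  hasDerivAt : ∀ k t, 0 ≤ t → HasDerivAt (f k) (f (k + 1) t) t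
  decay : ∃ b : ℝ, 0 < b ∧ ∀ k, ∃ C : ℝ, ∀ t, 0 ≤ t → ‖f k t‖ ≤ C * Real.exp (-b * t)

namespace IsExpDecayingTower

variable {f : ℕ → ℝ → ℂ} (hf : IsExpDecayingTower f)
include hf

lemma locallyIntegrableOn (k : ℕ) : LocallyIntegrableOn (f k) (Ioi 0) :=
  ContinuousOn.locallyIntegrableOn
    (fun t ht => (hf.hasDerivAt k t (le_of_lt ht)).continuousAt.continuousWithinAt) measurableSet_Ioi

lemma isBigO_atTop : ∃ b : ℝ, 0 < b ∧ ∀ k, f k =O[atTop] fun t => Real.exp (-b * t) := by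
  obtain ⟨b, hb, h⟩ := hf.decay
  refine ⟨b, hb, fun k => ?_⟩
  obtain ⟨C, hC⟩ := h k
  refine IsBigO.of_bound C ?_
  filter_upwards [eventually_ge_atTop 0] with t ht
  simpa [Real.abs_exp] using hC t ht

lemma isBigO_zero (k : ℕ) : f k =O[𝓝[>] 0] (fun t : ℝ => t ^ (-0 : ℝ)) := by
  have : Tendsto (f k) (𝓝[>] 0) (𝓝 (f k 0)) :=
    (hf.hasDerivAt k 0 le_rfl).continuousAt.tendsto.mono_left nhdsWithin_le_nhds
  simpa using this.isBigO_one ℝ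

lemma mellinConvergent (k : ℕ) {s : ℂ} (hs : 0 < s.re) : MellinConvergent (f k) s := by
  obtain ⟨b, hb, h⟩ := hf.isBigO_atTop
  exact mellinConvergent_of_isBigO_rpow_exp hb (hf.locallyIntegrableOn k) (h k)
    (hf.isBigO_zero k) hs

lemma differentiableAt_mellin (k : ℕ) {s : ℂ} (hs : 0 < s.re) :
    DifferentiableAt ℂ (mellin (f k)) s := by
  obtain ⟨b, hb, h⟩ := hf.isBigO_atTop
  exact mellin_differentiableAt_of_isBigO_rpow_exp hb (hf.locallyIntegrableOn k) (h k)
    (hf.isBigO_zero k) hs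

lemma tendsto_atTop (k : ℕ) (s : ℂ) : Tendsto (fun t : ℝ => (t : ℂ) ^ s * f k t) atTop (𝓝 0) := by
  obtain ⟨b, hb, h⟩ := hf.isBigO_atTop
  have h1 : (fun t : ℝ => (t : ℂ) ^ s) =O[atTop] fun t : ℝ => t ^ s.re := by
    refine IsBigO.of_bound 1 ?_
    filter_upwards [eventually_gt_atTop 0] with t ht
    rw [norm_cpow_eq_rpow_re_of_pos ht, one_mul]
    exact le_abs_self _
  have h2 := (h k).trans_isLittleO (isLittleO_exp_neg_mul_rpow_atTop hb (-s.re))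
  refine ((h1.mul_isLittleO h2).congr' EventuallyEq.rfl ?_).tendsto_zero_of_tendsto
    (tendsto_const_nhds (x := (1 : ℝ)))
  filter_upwards [eventually_gt_atTop 0] with t ht
  rw [← Real.rpow_add ht, add_neg_cancel, Real.rpow_zero]

/-- Integration by parts in the Mellin integral. -/
lemma mul_mellin (k : ℕ) {s : ℂ} (hs : 0 < s.re) :
    s * mellin (f k) s = -mellin (f (k + 1)) (s + 1) := by
  have hs0 : s ≠ 0 := by rintro rfl; simp at hs
  have hs1 : 0 < (s + 1).re := by simp; linarith
  have key := integral_Ioi_mul_deriv_eq_deriv_mul (a := 0) (a' := (0 : ℂ)) (b' := 0)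
    (u := fun t : ℝ => (t : ℂ) ^ s) (u' := fun t : ℝ => s * (t : ℂ) ^ (s - 1))
    (v := f k) (v' := f (k + 1))
    (fun t ht => by
      exact hasDerivAt_ofReal_cpow_const (ne_of_gt ht) hs0)
    (fun t ht => hf.hasDerivAt k t (le_of_lt ht))
    (by simpa [MellinConvergent, Pi.mul_def] using hf.mellinConvergent (k + 1) hs1)
    (by
      have := (hf.mellinConvergent k hs).const_mul s
      simpa [MellinConvergent, IntegrableOn, Pi.mul_def, mul_assoc] using this)
    (by
      have h1 : Tendsto (fun t : ℝ => (t : ℂ) ^ s) (𝓝[>] 0) (𝓝 0) := by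
        have := (continuousAt_ofReal_cpow_const 0 s (Or.inl hs)).tendsto
        rw [ofReal_zero, zero_cpow hs0] at this
        exact this.mono_left nhdsWithin_le_nhds
      have h2 : Tendsto (f k) (𝓝[>] 0) (𝓝 (f k 0)) :=
        (hf.hasDerivAt k 0 le_rfl).continuousAt.tendsto.mono_left nhdsWithin_le_nhds
      simpa only [Pi.mul_def, zero_mul] using h1.mul h2)
    (hf.tendsto_atTop k s)
  simp only [mul_assoc, integral_const_mul] at key
  simp only [mellin, smul_eq_mul, add_sub_cancel_right]
  linear_combination key

lemma mellin_one (k : ℕ) : mellin (f (k + 1)) 1 = -f k 0 := by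
  have h0 : Tendsto (f k) atTop (𝓝 0) := by simpa using hf.tendsto_atTop k 0
  have hi : IntegrableOn (f (k + 1)) (Ioi 0) := by
    simpa [MellinConvergent] using hf.mellinConvergent (k + 1) (s := 1) (by simp)
  have := integral_Ioi_of_hasDerivAt_of_tendsto' (fun t ht => hf.hasDerivAt k t ht) hi h0
  simpa [mellin] using this

/-- Integrating by parts `N` times does not change `Γ(s)⁻¹ ∫ f₀(t) t ^ (s - 1) dt`; the new integral
converges for `-N < Re s`. -/
lemma continuation_congr {N M : ℕ} (hNM : N ≤ M) {s : ℂ} (hs : -(N : ℝ) < s.re) :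
    (-1) ^ M * (Gamma (s + M))⁻¹ * mellin (f M) (s + M) =
      (-1) ^ N * (Gamma (s + N))⁻¹ * mellin (f N) (s + N) := by
  induction M, hNM using Nat.le_induction with
  | base => rfl
  | succ M hM ih =>
    have hM' : (N : ℝ) ≤ M := by exact_mod_cast hM
    have hp : 0 < (s + M).re := by simp; linarith
    have hne : s + M ≠ 0 := by intro h; simp [h] at hp
    have h1 := hf.mul_mellin M hp
    have h2 := Gamma_add_one (s + M) hne
    have h3 : Gamma (s + M) ≠ 0 := Gamma_ne_zero_of_re_pos hp
    rw [← ih]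
    push_cast
    rw [← add_assoc, h2, ← neg_eq_iff_eq_neg.mpr h1]
    field_simp
    ring

/-- The function `Γ(s)⁻¹ ∫ f₀(t) t ^ (s - 1) dt` extends to an entire function, whose value at `-n` is
`(-1) ^ n f₀⁽ⁿ⁾(0)`. -/
theorem exists_entire :
    ∃ L : ℂ → ℂ, Differentiable ℂ L ∧ (∀ s : ℂ, 0 < s.re → L s = (Gamma s)⁻¹ * mellin (f 0) s) ∧
      ∀ n : ℕ, L (-n) = (-1) ^ n * f n 0 := by
  set G : ℕ → ℂ → ℂ := fun N s => (-1) ^ N * (Gamma (s + N))⁻¹ * mellin (f N) (s + N) with hG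
  set L : ℂ → ℂ := fun s => G (⌊|s.re|⌋₊ + 1) s with hL
  have hLG : ∀ (N : ℕ) (s : ℂ), -(N : ℝ) < s.re → L s = G N s := by
    intro N s hs
    have h1 : -((⌊|s.re|⌋₊ + 1 : ℕ) : ℝ) < s.re := by
      have := Nat.lt_floor_add_one |s.re|
      have := neg_abs_le s.re
      push_cast
      linarith
    rcases le_total N (⌊|s.re|⌋₊ + 1) with h | h
    · exact hf.continuation_congr h hs
    · exact (hf.continuation_congr h h1).symm
  refine ⟨L, fun s => ?_, fun s hs => ?_, fun n => ?_⟩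
  · obtain ⟨N, hN⟩ := exists_nat_gt (-s.re)
    have hpos : 0 < (s + N).re := by simp; linarith
    have hd : DifferentiableAt ℂ (G N) s := by
      have h1 : DifferentiableAt ℂ (fun s : ℂ => (Gamma (s + N))⁻¹) s :=
        DifferentiableAt.fun_comp' (f := fun s : ℂ => s + N) s (differentiable_one_div_Gamma (s + N)) (
          differentiableAt_fun_id.add_const (N : ℂ))
      have h2 : DifferentiableAt ℂ (fun s : ℂ => mellin (f N) (s + N)) s :=
        DifferentiableAt.fun_comp' (f := fun s : ℂ => s + N) s (hf.differentiableAt_mellin N hpos) (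
          differentiableAt_fun_id.add_const (N : ℂ))
      exact (h1.const_mul _).mul h2
    refine hd.congr_of_eventuallyEq ?_
    have : ∀ᶠ z : ℂ in 𝓝 s, -(N : ℝ) < z.re :=
      continuous_re.continuousAt.eventually (lt_mem_nhds (by linarith))
    filter_upwards [this] with z hz using hLG N z hz
  · rw [hLG 0 s (by simpa using hs)]
    simp [hG]
  · rw [hLG (n + 1) (-n) (by simp)]
    simp only [hG, Nat.cast_add, Nat.cast_one, neg_add_cancel_left, Gamma_one,
      hf.mellin_one n]
    ring

end IsExpDecayingTower

end Mellin

/-! ### The generating function as a smooth function and as a power series -/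

section Jets

open PowerSeries

/-- Pairs of a function of `t` and a power series in `X = -t`: the exponentials `e ^ (-aⱼ t)` and the
factors `(1 - wⱼ e ^ (-aⱼ t))⁻¹`, together with their Taylor expansions at `0`. -/
def jetGenerators {r : ℕ} (a : Fin r → ℝ) (w : Fin r → ℂ) : Set ((ℝ → ℂ) × PowerSeries ℂ) :=
  {q | ∃ j, q = (fun t : ℝ => Complex.exp (-(a j * t)), rescale (a j : ℂ) (exp ℂ)) ∨
    q = (fun t : ℝ => (1 - w j * Complex.exp (-(a j * t)))⁻¹,
      (1 - C (w j) * rescale (a j : ℂ) (exp ℂ))⁻¹)}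

lemma derivative_rescale_exp (c : ℂ) :
    d⁄dX ℂ (rescale c (exp ℂ)) = C c * rescale c (exp ℂ) := by
  ext n
  simp only [coeff_derivative, coeff_rescale, coeff_exp, coeff_C_mul, one_div, map_inv₀, map_natCast,
    Nat.factorial_succ, Nat.cast_mul, Nat.cast_succ, pow_succ, map_mul, map_add, map_one]
  have : (n : ℂ) + 1 ≠ 0 := by exact_mod_cast n.succ_ne_zero
  have : (n.factorial : ℂ) ≠ 0 := by exact_mod_cast n.factorial_ne_zero
  field_simp

lemma constantCoeff_rescale_exp (c : ℂ) : constantCoeff (rescale c (exp ℂ)) = 1 := by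
  rw [← coeff_zero_eq_constantCoeff_apply, coeff_rescale, coeff_exp]
  simp

/-- For `‖w‖ ≤ 1` and `w ≠ 1`, the segment `w [0, 1]` avoids `1`; by compactness
`(1 - w e ^ (-a t))⁻¹` is bounded on `[0, ∞)`, the endpoint `t = 0` included. -/
lemma exists_bound_inv_one_sub_mul_exp {a : ℝ} (ha : 0 < a) {w : ℂ} (hw : ‖w‖ ≤ 1) (hw1 : w ≠ 1) :
    (∀ t : ℝ, 0 ≤ t → 1 - w * Complex.exp (-(a * t)) ≠ 0) ∧
      ∃ B : ℝ, ∀ t : ℝ, 0 ≤ t → ‖(1 - w * Complex.exp (-(a * t)))⁻¹‖ ≤ B := by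
  have hne : ∀ c ∈ Set.Icc (0 : ℝ) 1, 1 - w * c ≠ 0 := by
    rintro c ⟨hc0, hc1⟩ h
    have h1 : w * c = 1 := by linear_combination -h
    have h2 : ‖w‖ * c = 1 := by simpa [abs_of_nonneg hc0] using congrArg norm h1
    have h3 : c = 1 := by nlinarith
    apply hw1
    simpa [h3] using h1
  have hmem : ∀ t : ℝ, 0 ≤ t → Real.exp (-(a * t)) ∈ Set.Icc (0 : ℝ) 1 := fun t ht =>
    ⟨(Real.exp_pos _).le, Real.exp_le_one_iff.mpr (by nlinarith [mul_nonneg ha.le ht])⟩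
  have hcast : ∀ t : ℝ, Complex.exp (-(a * t)) = (Real.exp (-(a * t)) : ℝ) := fun t => by
    push_cast
    rfl
  refine ⟨fun t ht => by rw [hcast]; exact hne _ (hmem t ht), ?_⟩
  have hc : ContinuousOn (fun c : ℝ => (1 - w * (c : ℂ))⁻¹) (Set.Icc 0 1) :=
    ContinuousOn.inv₀ (by fun_prop) hne
  obtain ⟨B, hB⟩ := isCompact_Icc.exists_bound_of_continuousOn hc
  exact ⟨B, fun t ht => by rw [hcast]; exact hB _ (hmem t ht)⟩

variable {r : ℕ} {a : Fin r → ℝ} {w : Fin r → ℂ}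

/-- The algebra generated by `jetGenerators` consists of functions bounded on `[0, ∞)`, whose
value at `0` is the constant coefficient of the power series, and is closed under `(d/dt, -d/dX)`. -/
lemma jet_properties (ha : ∀ j, 0 < a j) (hw : ∀ j, ‖w j‖ ≤ 1) (hw1 : ∀ j, w j ≠ 1)
    {q : (ℝ → ℂ) × PowerSeries ℂ} (hq : q ∈ Algebra.adjoin ℂ (jetGenerators a w)) :
    (∃ B : ℝ, ∀ t : ℝ, 0 ≤ t → ‖q.1 t‖ ≤ B) ∧ q.1 0 = constantCoeff q.2 ∧
      ∃ q' ∈ Algebra.adjoin ℂ (jetGenerators a w),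
        (∀ t : ℝ, 0 ≤ t → HasDerivAt q.1 (q'.1 t) t) ∧ d⁄dX ℂ q.2 = -q'.2 := by
  have hexp : ∀ (j : Fin r) (t : ℝ), HasDerivAt (fun t : ℝ => Complex.exp (-(a j * t)))
      (-(a j : ℂ) * Complex.exp (-(a j * t))) t := fun j t => by
    have h1 : HasDerivAt (fun t : ℝ => -((a j : ℂ) * t)) (-((a j : ℂ) * 1)) t :=
      ((Complex.ofRealCLM.hasDerivAt (x := t)).const_mul (a j : ℂ)).neg
    simpa [mul_comm] using h1.cexp
  induction hq using Algebra.adjoin_induction with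
  | mem q hq =>
    obtain ⟨j, hj⟩ := hq
    have mem1 := Algebra.subset_adjoin (R := ℂ) (s := jetGenerators a w) ⟨j, Or.inl rfl⟩
    have mem2 := Algebra.subset_adjoin (R := ℂ) (s := jetGenerators a w) ⟨j, Or.inr rfl⟩
    rcases hj with rfl | rfl
    · refine ⟨⟨1, fun t ht => ?_⟩, ?_, _, Subalgebra.smul_mem _ mem1 (-(a j : ℂ)), fun t ht => ?_, ?_⟩
      · rw [Complex.norm_exp]
        have := mul_nonneg (ha j).le ht
        simpa using this
      · simp [constantCoeff_rescale_exp]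
      · simpa using hexp j t
      · simp [derivative_rescale_exp, smul_eq_C_mul]
    · obtain ⟨hne, B, hB⟩ := exists_bound_inv_one_sub_mul_exp (ha j) (hw j) (hw1 j)
      refine ⟨⟨B, hB⟩, ?_, _, Subalgebra.smul_mem _ (mul_mem mem1 (pow_mem mem2 2))
        (-(a j * w j : ℂ)), fun t ht => ?_, ?_⟩
      · simp [constantCoeff_rescale_exp, PowerSeries.constantCoeff_inv]
      · have := (((hexp j t).const_mul (w j)).const_sub 1).inv (hne t ht)
        convert! this using 1
        simp only [Prod.smul_fst, Prod.fst_mul, Prod.pow_fst, Pi.smul_apply, Pi.mul_apply,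
          Pi.pow_apply, smul_eq_mul]
        field_simp [hne t ht]
      · simp only [derivative_inv', map_sub, derivative_one, Derivation.leibniz, derivative_C,
          derivative_rescale_exp, smul_eq_C_mul, smul_eq_mul, Prod.smul_snd, Prod.snd_mul,
          Prod.pow_snd, map_neg, map_mul]
        ring
  | algebraMap c =>
    refine ⟨⟨‖c‖, fun t _ => ?_⟩, ?_, 0, zero_mem _, fun t _ => ?_, ?_⟩
    · simp [Prod.algebraMap_apply]
    · simp [Prod.algebraMap_apply]
    · exact hasDerivAt_const t c
    · simp [Prod.algebraMap_apply]
  | add p q _ _ hp hq =>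
    obtain ⟨⟨B, hB⟩, hp0, p', hp', hpd, hps⟩ := hp
    obtain ⟨⟨D, hD⟩, hq0, q', hq', hqd, hqs⟩ := hq
    refine ⟨⟨B + D, fun t ht => (norm_add_le _ _).trans (add_le_add (hB t ht) (hD t ht))⟩, ?_,
      p' + q', add_mem hp' hq', fun t ht => (hpd t ht).add (hqd t ht), ?_⟩
    · simp [hp0, hq0]
    · simp only [Prod.snd_add, map_add, hps, hqs]
      ring
  | mul p q hpm hqm hp hq =>
    obtain ⟨⟨B, hB⟩, hp0, p', hp', hpd, hps⟩ := hp
    obtain ⟨⟨D, hD⟩, hq0, q', hq', hqd, hqs⟩ := hq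
    refine ⟨⟨B * D, fun t ht => ?_⟩, ?_, p' * q + p * q',
      add_mem (mul_mem hp' hqm) (mul_mem hpm hq'), fun t ht => (hpd t ht).mul (hqd t ht), ?_⟩
    · have := (norm_nonneg _).trans (hB t ht)
      simpa using mul_le_mul (hB t ht) (hD t ht) (norm_nonneg _) this
    · simp [hp0, hq0]
    · simp only [Prod.snd_add, Prod.snd_mul, Derivation.leibniz, smul_eq_mul, hps, hqs]
      ring

/-- Multiplying by `e ^ (-x t)` turns each pair of the algebra into a tower of exponentially decaying
derivatives, whose values at `0` are, up to sign and factorials, the coefficients of the power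
series. -/
theorem exists_tower (ha : ∀ j, 0 < a j) (hw : ∀ j, ‖w j‖ ≤ 1) (hw1 : ∀ j, w j ≠ 1) {x : ℂ}
    (hx : 0 < x.re) {q : (ℝ → ℂ) × PowerSeries ℂ} (hq : q ∈ Algebra.adjoin ℂ (jetGenerators a w)) :
    ∃ f : ℕ → ℝ → ℂ, IsExpDecayingTower f ∧ (f 0 = fun t : ℝ => Complex.exp (-(x * t)) * q.1 t) ∧
      ∀ n : ℕ, (-1) ^ n * f n 0 =
        (n.factorial : ℂ) * coeff n (q.2 * rescale x (exp ℂ)) := by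
  have H := fun p : Algebra.adjoin ℂ (jetGenerators a w) => jet_properties ha hw hw1 p.2
  choose hB h0 D hDm hD hDs using H
  choose B hB using hB
  -- `(d/dt)(e ^ (-x t) h) = e ^ (-x t) (h' - x h)`
  set Q : ℕ → Algebra.adjoin ℂ (jetGenerators a w) :=
    fun n => Nat.rec ⟨q, hq⟩ (fun _ p => ⟨D p, hDm p⟩ - x • p) n with hQ
  have hQs : ∀ n, Q (n + 1) = ⟨D (Q n), hDm (Q n)⟩ - x • Q n := fun n => rfl
  refine ⟨fun n t => Complex.exp (-(x * t)) * (Q n).1.1 t, ⟨fun k t ht => ?_, x.re, hx, fun k => ?_⟩,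
    rfl, fun n => ?_⟩
  · have h1 : HasDerivAt (fun t : ℝ => -(x * (t : ℂ))) (-(x * 1)) t :=
      ((Complex.ofRealCLM.hasDerivAt (x := t)).const_mul x).neg
    convert! h1.cexp.mul (hD (Q k) t ht) using 1
    simp only [hQs]
    simp
    ring
  · refine ⟨B (Q k), fun t ht => ?_⟩
    rw [norm_mul, Complex.norm_exp, mul_comm]
    simpa using mul_le_mul_of_nonneg_right (hB (Q k) t ht) (Real.exp_pos _).le
  · have hder : ∀ n, d⁄dX ℂ ((Q n).1.2 * rescale x (exp ℂ)) =
        -((Q (n + 1)).1.2 * rescale x (exp ℂ)) := fun n => by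
      simp only [hQs, Derivation.leibniz, hDs, derivative_rescale_exp]
      simp [smul_eq_C_mul]
      ring
    have hit : ∀ n, (⇑(d⁄dX ℂ))^[n] (q.2 * rescale x (exp ℂ)) =
        C ((-1) ^ n) * ((Q n).1.2 * rescale x (exp ℂ)) := fun n => by
      induction n with
      | zero => simp [hQ]
      | succ n ih =>
        rw [Function.iterate_succ_apply', ih, Derivation.leibniz, derivative_C, hder, pow_succ, map_mul]
        simp
    have := congrArg constantCoeff (hit n)
    rw [constantCoeff_iterate_derivative] at this
    rw [this]
    simp [h0, constantCoeff_rescale_exp]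

end Jets

/-! ### The series as a Mellin transform -/

section Series

open MeasureTheory Set Filter Topology

/-- Absolutely convergent series multiply out to a series over multi-indices. -/
theorem hasSum_pi_prod {r : ℕ} {𝕜 : Type*} [NormedField 𝕜] [CompleteSpace 𝕜] (f : Fin r → ℕ → 𝕜)
    (hf : ∀ j, Summable fun n => ‖f j n‖) :
    (Summable fun m : Fin r → ℕ => ‖∏ j, f j (m j)‖) ∧
      HasSum (fun m : Fin r → ℕ => ∏ j, f j (m j)) (∏ j, ∑' n, f j n) := by
  induction r with
  | zero =>
    exact ⟨(hasSum_fintype _).summable, by simp⟩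
  | succ r ih =>
    obtain ⟨h1, h2⟩ := ih (fun j => f j.succ) (fun j => hf j.succ)
    have hs : Summable fun p : ℕ × (Fin r → ℕ) => ‖f 0 p.1 * ∏ j, f (Fin.succ j) (p.2 j)‖ :=
      Summable.mul_norm (f := f 0) (g := fun m : Fin r → ℕ => ∏ j, f (Fin.succ j) (m j)) (hf 0) h1
    have h0 : HasSum (f 0) (∑' n, f 0 n) := (hf 0).of_norm.hasSum
    have hsum : HasSum (fun p : ℕ × (Fin r → ℕ) => f 0 p.1 * ∏ j, f (Fin.succ j) (p.2 j))
        ((∑' n, f 0 n) * ∏ j, ∑' n, f (Fin.succ j) n) := by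
      have h3 : Summable fun p : ℕ × (Fin r → ℕ) => f 0 p.1 * ∏ j, f (Fin.succ j) (p.2 j) :=
        hs.of_norm
      exact HasSum.mul (f := f 0) (g := fun m : Fin r → ℕ => ∏ j, f (Fin.succ j) (m j)) h0 h2 h3
    rw [← (Fin.consEquiv (fun _ => ℕ)).summable_iff, ← (Fin.consEquiv (fun _ => ℕ)).hasSum_iff,
      Fin.prod_univ_succ]
    constructor
    · convert! hs using 2 with p
      simp [Fin.consEquiv, Fin.prod_univ_succ]
    · convert! hsum using 2 with p
      simp [Fin.consEquiv, Fin.prod_univ_succ]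

lemma summable_one_add_mul_rpow {b q : ℝ} (hb : 0 < b) (hq : 1 < q) :
    Summable fun n : ℕ => (1 + n * b) ^ (-q) := by
  have h := ((Real.summable_one_div_nat_add_rpow b⁻¹ q).mpr hq).mul_left (b ^ (-q))
  refine h.congr fun n => ?_
  have h0 : (0 : ℝ) < n + b⁻¹ := by positivity
  rw [abs_of_pos h0, one_div, ← Real.rpow_neg h0.le, ← Real.mul_rpow hb.le h0.le]
  congr 1
  field_simp
  ring

/-- A multiple Dirichlet series with linear terms in `r` indices converges for exponents larger than
`r`. -/
theorem summable_linear_rpow {r : ℕ} {a : Fin r → ℝ} (ha : ∀ j, 0 < a j) {y σ : ℝ} (hy : 0 < y)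
    (hσ : (r : ℝ) < σ) : Summable fun m : Fin r → ℕ => (y + ∑ j, m j * a j) ^ (-σ) := by
  obtain ⟨q, hq1, hq⟩ : ∃ q : ℝ, 1 < q ∧ q * r ≤ σ := by
    rcases Nat.eq_zero_or_pos r with rfl | h
    · exact ⟨2, by norm_num, by simpa using hσ.le⟩
    · have h' : (0 : ℝ) < r := by exact_mod_cast h
      exact ⟨σ / r, (one_lt_div h').mpr hσ, (div_mul_cancel₀ _ h'.ne').le⟩
  have hs := ((hasSum_pi_prod (fun j (n : ℕ) => (1 + n * (a j / y)) ^ (-q)) fun j =>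
    (summable_one_add_mul_rpow (div_pos (ha j) hy) hq1).norm).2.summable).mul_left (y ^ (-σ))
  refine Summable.of_nonneg_of_le (fun m => ?_) (fun m => ?_) hs
  · have : 0 ≤ ∑ j, (m j : ℝ) * a j := Finset.sum_nonneg fun j _ => by have := ha j; positivity
    positivity
  · -- with `T = (y + m · a) / y ≥ 1 + mⱼ aⱼ / y`, split `T ^ (-σ) ≤ T ^ (-q r) = ∏ⱼ T ^ (-q)`
    have hS : 0 ≤ ∑ j, (m j : ℝ) * a j := Finset.sum_nonneg fun j _ => by have := ha j; positivity
    set T : ℝ := 1 + (∑ j, (m j : ℝ) * a j) / y with hT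
    have hT1 : 1 ≤ T := by rw [hT]; have := div_nonneg hS hy.le; linarith
    have hTy : y + ∑ j, (m j : ℝ) * a j = y * T := by rw [hT]; field_simp
    rw [hTy, Real.mul_rpow hy.le (by linarith)]
    refine mul_le_mul_of_nonneg_left ?_ (by positivity)
    calc T ^ (-σ) ≤ T ^ (-q * r) := Real.rpow_le_rpow_of_exponent_le hT1 (by linarith)
      _ = ∏ _j : Fin r, T ^ (-q) := by
        rw [Real.rpow_mul (by linarith), Real.rpow_natCast]
        simp
      _ ≤ _ := Finset.prod_le_prod (fun _ _ => by positivity) fun j _ => by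
        have h1 : (m j : ℝ) * a j ≤ ∑ j, (m j : ℝ) * a j :=
          Finset.single_le_sum (f := fun j => (m j : ℝ) * a j)
            (fun i _ => by have := ha i; positivity) (Finset.mem_univ j)
        have h2 : 1 + (m j : ℝ) * (a j / y) ≤ T := by
          rw [hT, ← mul_div_assoc]
          have := div_le_div_of_nonneg_right h1 hy.le
          linarith
        have := ha j
        exact Real.rpow_le_rpow_of_nonpos (by positivity) h2 (by linarith)

lemma integrableOn_rpow_mul_exp {σ c : ℝ} (hσ : 0 < σ) (hc : 0 < c) :
    IntegrableOn (fun t : ℝ => t ^ (σ - 1) * Real.exp (-(c * t))) (Ioi 0) := by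
  have := integrableOn_rpow_mul_exp_neg_mul_rpow (s := σ - 1) (by linarith) one_pos hc
  simpa using this

lemma norm_cpow_mul_exp {s z : ℂ} {t : ℝ} (ht : 0 < t) :
    ‖(t : ℂ) ^ (s - 1) * Complex.exp (-(z * t))‖ = t ^ (s.re - 1) * Real.exp (-(z.re * t)) := by
  rw [norm_mul, Complex.norm_cpow_eq_rpow_re_of_pos ht, Complex.norm_exp]
  simp

lemma aestronglyMeasurable_cpow_mul_exp (s z : ℂ) :
    AEStronglyMeasurable (fun t : ℝ => (t : ℂ) ^ (s - 1) * Complex.exp (-(z * t)))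
      (volume.restrict (Ioi 0)) := by
  refine ContinuousOn.aestronglyMeasurable (fun t ht => ?_) measurableSet_Ioi
  refine (ContinuousAt.mul ?_ (by fun_prop)).continuousWithinAt
  exact Complex.continuousAt_ofReal_cpow_const t _ (Or.inr (ne_of_gt ht))

lemma integrableOn_cpow_mul_exp {s z : ℂ} (hs : 0 < s.re) (hz : 0 < z.re) :
    IntegrableOn (fun t : ℝ => (t : ℂ) ^ (s - 1) * Complex.exp (-(z * t))) (Ioi 0) := by
  refine (integrableOn_rpow_mul_exp hs hz).mono' (aestronglyMeasurable_cpow_mul_exp s z) ?_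
  filter_upwards [ae_restrict_mem measurableSet_Ioi] with t ht
  rw [norm_cpow_mul_exp ht]

/-- The Gamma integral with a complex rate in the right half-plane: both sides are holomorphic in the
rate and agree for positive reals. -/
theorem integral_cpow_mul_exp_neg_complex_mul {s z : ℂ} (hs : 0 < s.re) (hz : 0 < z.re) :
    ∫ t : ℝ in Ioi 0, (t : ℂ) ^ (s - 1) * Complex.exp (-(z * t)) = z ^ (-s) * Complex.Gamma s := by
  set U : Set ℂ := {z | 0 < z.re} with hU
  have hUo : IsOpen U := isOpen_lt continuous_const Complex.continuous_re
  have hF : DifferentiableOn ℂ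
      (fun z : ℂ => ∫ t : ℝ in Ioi 0, (t : ℂ) ^ (s - 1) * Complex.exp (-(z * t))) U := by
    intro z₀ (hz₀ : 0 < z₀.re)
    have hV : {z : ℂ | z₀.re / 2 < z.re} ∈ 𝓝 z₀ :=
      (isOpen_lt continuous_const Complex.continuous_re).mem_nhds
        (by simp only [mem_ofPred_eq]; linarith)
    refine (hasDerivAt_integral_of_dominated_loc_of_deriv_le (μ := volume.restrict (Ioi 0))
      (F := fun (z : ℂ) (t : ℝ) => (t : ℂ) ^ (s - 1) * Complex.exp (-(z * t)))
      (F' := fun (z : ℂ) (t : ℝ) => -((t : ℂ) ^ (s + 1 - 1) * Complex.exp (-(z * t))))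
      (bound := fun t : ℝ => t ^ (s.re + 1 - 1) * Real.exp (-(z₀.re / 2 * t)))
      hV (Eventually.of_forall fun z => aestronglyMeasurable_cpow_mul_exp s z)
      (integrableOn_cpow_mul_exp hs hz₀) (aestronglyMeasurable_cpow_mul_exp (s + 1) z₀).neg ?_
      (integrableOn_rpow_mul_exp (by linarith) (by linarith))
      ?_).2.differentiableAt.differentiableWithinAt
    · filter_upwards [ae_restrict_mem measurableSet_Ioi] with t ht z hzV
      have ht' : 0 < t := ht
      have hzV' : z₀.re / 2 < z.re := hzV
      rw [norm_neg, norm_cpow_mul_exp ht']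
      simp only [Complex.add_re, Complex.one_re]
      gcongr
    · filter_upwards [ae_restrict_mem measurableSet_Ioi] with t ht z _
      have ht0 : (t : ℂ) ≠ 0 := Complex.ofReal_ne_zero.mpr (ne_of_gt ht)
      have h1 : HasDerivAt (fun z : ℂ => -(z * (t : ℂ))) (-(1 * (t : ℂ))) z :=
        ((hasDerivAt_id z).mul_const (t : ℂ)).neg
      convert! h1.cexp.const_mul ((t : ℂ) ^ (s - 1)) using 1
      rw [add_sub_right_comm, Complex.cpow_add _ _ ht0, Complex.cpow_one]
      ring
  have hG : DifferentiableOn ℂ (fun z : ℂ => z ^ (-s) * Complex.Gamma s) U := fun z hz =>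
    ((differentiableAt_id.cpow_const (Or.inl hz)).mul_const _).differentiableWithinAt
  refine (hF.analyticOnNhd hUo).eqOn_of_preconnected_of_frequently_eq (hG.analyticOnNhd hUo)
    (convex_halfSpace_re_gt 0).isPreconnected (z₀ := 1) (by simp [hU]) ?_ hz
  have hmap : Tendsto (fun x : ℝ => (x : ℂ)) (𝓝[≠] 1) (𝓝[≠] 1) := by
    refine tendsto_nhdsWithin_iff.mpr ⟨?_, ?_⟩
    · have : ContinuousAt (fun x : ℝ => (x : ℂ)) 1 := by fun_prop
      simpa using this.tendsto.mono_left nhdsWithin_le_nhds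
    · filter_upwards [self_mem_nhdsWithin] with x hx
      simpa using hx
  refine hmap.frequently (Eventually.frequently ?_)
  have : ∀ᶠ x : ℝ in 𝓝[≠] 1, 0 < x := nhdsWithin_le_nhds (lt_mem_nhds one_pos)
  filter_upwards [this] with x hx
  rw [Complex.integral_cpow_mul_exp_neg_mul_Ioi hs hx, one_div, Complex.inv_cpow, Complex.cpow_neg]
  rw [Complex.arg_ofReal_of_nonneg hx.le]
  exact Real.pi_pos.ne

/-- Termwise integration: for `Re s > r` the multiple series is `Γ(s)⁻¹` times a Mellin transform. -/
theorem hasSum_mellin_multiple {r : ℕ} {a : Fin r → ℝ} (ha : ∀ j, 0 < a j) {w : Fin r → ℂ}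
    (hw : ∀ j, ‖w j‖ ≤ 1) {x s : ℂ} (hx : 0 < x.re) (hs : (r : ℝ) < s.re) :
    HasSum (fun m : Fin r → ℕ => (∏ j, w j ^ m j) * (x + ∑ j, (m j : ℂ) * (a j : ℂ)) ^ (-s))
      ((Complex.Gamma s)⁻¹ * mellin (fun t : ℝ => Complex.exp (-(x * t)) *
        ∏ j, (1 - w j * Complex.exp (-(a j * t)))⁻¹) s) := by
  have hs0 : 0 < s.re := (Nat.cast_nonneg r).trans_lt hs
  have hre : ∀ m : Fin r → ℕ, (x + ∑ j, (m j : ℂ) * (a j : ℂ)).re = x.re + ∑ j, m j * a j := by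
    intro m
    simp
  have hpos : ∀ m : Fin r → ℕ, 0 < (x + ∑ j, (m j : ℂ) * (a j : ℂ)).re := by
    intro m
    rw [hre]
    have : 0 ≤ ∑ j, (m j : ℝ) * a j := Finset.sum_nonneg fun j _ => by have := ha j; positivity
    linarith
  have hwm : ∀ m : Fin r → ℕ, ‖∏ j, w j ^ m j‖ ≤ 1 := fun m => by
    rw [norm_prod]
    exact Finset.prod_le_one (fun _ _ => norm_nonneg _) fun j _ => by
      rw [norm_pow]
      exact pow_le_one₀ (norm_nonneg _) (hw j)
  set F : (Fin r → ℕ) → ℝ → ℂ := fun m t => (∏ j, w j ^ m j) *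
    ((t : ℂ) ^ (s - 1) * Complex.exp (-((x + ∑ j, (m j : ℂ) * (a j : ℂ)) * t))) with hF
  have hint : ∀ m, IntegrableOn (F m) (Ioi 0) := fun m =>
    (integrableOn_cpow_mul_exp hs0 (hpos m)).const_mul _
  have hval : ∀ m, ∫ t in Ioi 0, F m t = (∏ j, w j ^ m j) *
      ((x + ∑ j, (m j : ℂ) * (a j : ℂ)) ^ (-s) * Complex.Gamma s) := fun m => by
    rw [hF, integral_const_mul, integral_cpow_mul_exp_neg_complex_mul hs0 (hpos m)]
  have hnorm : ∀ m, ∫ t in Ioi 0, ‖F m t‖ ≤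
      (x.re + ∑ j, m j * a j) ^ (-s.re) * Real.Gamma s.re := fun m => by
    have hm := hpos m
    have h1 : ∫ t in Ioi 0, ‖F m t‖ ≤
        ∫ t in Ioi 0, t ^ (s.re - 1) * Real.exp (-((x.re + ∑ j, m j * a j) * t)) := by
      rw [← hre]
      refine setIntegral_mono_on (hint m).norm (integrableOn_rpow_mul_exp hs0 hm)
        measurableSet_Ioi fun t ht => ?_
      rw [hF]
      dsimp only
      rw [norm_mul, norm_cpow_mul_exp ht]
      have ht' : 0 < t := ht
      exact mul_le_of_le_one_left (by positivity) (hwm m)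
    rw [hre] at hm
    rw [Real.integral_rpow_mul_exp_neg_mul_Ioi hs0 hm, one_div, Real.inv_rpow hm.le,
      ← Real.rpow_neg hm.le] at h1
    exact h1
  have hsummable : Summable fun m => ∫ t in Ioi 0, ‖F m t‖ :=
    Summable.of_nonneg_of_le (fun m => integral_nonneg fun t => norm_nonneg _) hnorm
      ((summable_linear_rpow ha hx hs).mul_right _)
  have hpt : ∀ t ∈ Ioi (0 : ℝ), ∑' m, F m t = (t : ℂ) ^ (s - 1) • (Complex.exp (-(x * t)) *
      ∏ j, (1 - w j * Complex.exp (-(a j * t)))⁻¹) := fun t ht => by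
    have hlt : ∀ j, ‖w j * Complex.exp (-(a j * t))‖ < 1 := fun j => by
      have h1 : Real.exp (-(a j * t)) < 1 := by
        rw [Real.exp_lt_one_iff]
        exact neg_lt_zero.mpr (mul_pos (ha j) ht)
      rw [norm_mul, Complex.norm_exp]
      simp only [Complex.neg_re, Complex.re_ofReal_mul, Complex.ofReal_re]
      exact (mul_le_of_le_one_left (Real.exp_pos _).le (hw j)).trans_lt h1
    have h := (hasSum_pi_prod (fun j (n : ℕ) => (w j * Complex.exp (-(a j * t))) ^ n) fun j => by
      simpa using summable_geometric_of_lt_one (norm_nonneg _) (hlt j)).2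
    simp only [tsum_geometric_of_norm_lt_one (hlt _)] at h
    refine ((h.mul_left ((t : ℂ) ^ (s - 1) * Complex.exp (-(x * t)))).congr_fun ?_).tsum_eq.trans
      (by rw [smul_eq_mul, mul_assoc])
    intro m
    simp only [hF, mul_pow, Finset.prod_mul_distrib, ← Complex.exp_nat_mul, ← Complex.exp_sum]
    rw [add_mul, neg_add, Complex.exp_add, Finset.sum_mul, ← Finset.sum_neg_distrib]
    simp only [mul_neg, mul_assoc]
    ring
  have key := hasSum_integral_of_summable_integral_norm hint hsummable
  rw [setIntegral_congr_fun measurableSet_Ioi hpt] at key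
  have hΓ : Complex.Gamma s ≠ 0 := Complex.Gamma_ne_zero_of_re_pos hs0
  simp only [hval] at key
  convert! key.mul_left (Complex.Gamma s)⁻¹ using 2 with m
  field_simp

end Series

/-! ### The Frobenius–Euler `l`-function -/

section FrobeniusEuler

variable {r : ℕ} {a : Fin r → ℝ} {u x : ℂ}

lemma multipleLTerm_eq (hu : u ≠ 0) (s : ℂ) (m : Fin r → ℕ) :
    multipleLTerm s x u a m = (∏ j, (u ^ (-(a j : ℂ))) ^ m j) *
      (x + ∑ j, (m j : ℂ) * (a j : ℂ)) ^ (-s) := by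
  rw [multipleLTerm, div_eq_mul_inv, ← Complex.cpow_neg]
  congr 1
  simp only [Complex.cpow_def_of_ne_zero hu, ← Complex.exp_nat_mul, ← Complex.exp_sum]
  congr 1
  rw [mul_neg, Finset.mul_sum, ← Finset.sum_neg_distrib]
  exact Finset.sum_congr rfl fun j _ => by ring

open PowerSeries in
/-- Multiplying numerator and denominator of each factor by `-u ^ (-aⱼ)`. -/
lemma frobeniusEulerGenFun_eq (hu : u ≠ 0) (hua : ∀ j, u ^ (a j : ℂ) ≠ 1) :
    frobeniusEulerGenFun a u x = C (∏ j, (1 - u ^ (-(a j : ℂ)))) *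
      ((∏ j, (1 - C (u ^ (-(a j : ℂ))) * rescale (a j : ℂ) (exp ℂ))⁻¹) * rescale x (exp ℂ)) := by
  rw [frobeniusEulerGenFun, map_prod, ← mul_assoc, ← Finset.prod_mul_distrib]
  congr 1
  refine Finset.prod_congr rfl fun j _ => ?_
  have hU : u ^ (a j : ℂ) ≠ 0 := by simp [Complex.cpow_eq_zero_iff, hu]
  rw [Complex.cpow_neg]
  have hU1 := hua j
  generalize u ^ (a j : ℂ) = U at hU hU1
  set E := rescale (a j : ℂ) (exp ℂ)
  have hE : constantCoeff E = 1 := constantCoeff_rescale_exp _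
  have h1 : constantCoeff (E - C U) ≠ 0 := by
    simpa [hE, sub_eq_zero] using hU1.symm
  have h2 : constantCoeff (1 - C U⁻¹ * E) ≠ 0 := by
    have : (1 : ℂ) - U⁻¹ ≠ 0 := sub_ne_zero.mpr fun h => hU1 (inv_eq_one.mp h.symm)
    simpa [hE] using this
  have hC : (C U : PowerSeries ℂ) * C U⁻¹ = 1 := by rw [← map_mul, mul_inv_cancel₀ hU, map_one]
  rw [PowerSeries.eq_mul_inv_iff_mul_eq h2, mul_right_comm, eq_comm,
    PowerSeries.eq_mul_inv_iff_mul_eq h1]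
  simp only [map_sub, map_one]
  linear_combination (1 - E) * hC

/-- The analytic continuation together with its values at the non-positive integers. -/
theorem exists_isMultipleL (ha : ∀ j, 0 < a j) (hu : 1 ≤ ‖u‖) (hua : ∀ j, u ^ (a j : ℂ) ≠ 1)
    (hx : 0 < x.re) : ∃ L : ℂ → ℂ, IsMultipleL x u a L ∧ ∀ n : ℕ,
      (∏ j, (1 - u ^ (-(a j : ℂ)))) * L (-(n : ℂ)) = multipleFrobeniusEuler n x u a := by
  have hu0 : u ≠ 0 := by rintro rfl; simp at hu; linarith
  set w : Fin r → ℂ := fun j => u ^ (-(a j : ℂ)) with hw_def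
  have hw : ∀ j, ‖w j‖ ≤ 1 := fun j => by
    have h : ‖w j‖ = ‖u‖ ^ (-a j) := by
      rw [← Complex.norm_cpow_real, Complex.ofReal_neg]
    rw [h]
    exact Real.rpow_le_one_of_one_le_of_nonpos hu (neg_nonpos.mpr (ha j).le)
  have hw1 : ∀ j, w j ≠ 1 := fun j => by
    simpa [hw_def, Complex.cpow_neg] using hua j
  obtain ⟨f, hf, hf0, hfn⟩ := exists_tower ha hw hw1 hx
    (prod_mem (S := Algebra.adjoin ℂ (jetGenerators a w)) (t := Finset.univ)
      fun j _ => Algebra.subset_adjoin ⟨j, Or.inr rfl⟩)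
  obtain ⟨L, hL, hLM, hLn⟩ := hf.exists_entire
  refine ⟨L, ⟨hL, fun s hs => ?_⟩, fun n => ?_⟩
  · rw [hLM s ((Nat.cast_nonneg r).trans_lt hs), hf0]
    simp only [multipleLTerm_eq hu0, Prod.fst_prod, Finset.prod_apply]
    exact hasSum_mellin_multiple ha hw hx hs
  · rw [hLn, hfn, multipleFrobeniusEuler, frobeniusEulerGenFun_eq hu0 hua, PowerSeries.coeff_C_mul,
      Prod.snd_prod]
    ring

lemma IsMultipleL.unique {L M : ℂ → ℂ} (hL : IsMultipleL x u a L) (hM : IsMultipleL x u a M) :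
    L = M := by
  refine AnalyticOnNhd.eq_of_eventuallyEq (z₀ := ((r + 1 : ℝ) : ℂ))
    (Complex.analyticOnNhd_univ_iff_differentiable.mpr hL.entire)
    (Complex.analyticOnNhd_univ_iff_differentiable.mpr hM.entire) ?_
  have : ∀ᶠ s : ℂ in nhds ((r + 1 : ℝ) : ℂ), (r : ℝ) < s.re :=
    Complex.continuous_re.continuousAt.eventually (lt_mem_nhds (by simp))
  filter_upwards [this] with s hs using (hL.hasSum s hs).unique (hM.hasSum s hs)

end FrobeniusEuler

theorem theorem2p1 (r : ℕ) (a : Fin r → ℝ) (ha : ∀ j, 0 < a j)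
    (u : ℂ) (hu : 1 ≤ ‖u‖) (hua : ∀ j, u ^ (a j : ℂ) ≠ 1) (x : ℂ) (hx : 0 < x.re) :
    (∃! L : ℂ → ℂ, IsMultipleL x u a L) ∧
      ∀ L : ℂ → ℂ, IsMultipleL x u a L → ∀ n : ℕ,
        (∏ j, (1 - u ^ (-(a j : ℂ)))) * L (-(n : ℂ)) = multipleFrobeniusEuler n x u a := by
  obtain ⟨L, hL, hLn⟩ := exists_isMultipleL ha hu hua hx
  refine ⟨⟨L, hL, fun M hM => hM.unique hL⟩, fun M hM n => ?_⟩
  rw [hM.unique hL]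
  exact hLn n
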